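/- A $3$-graph $G$ on $[n]=\{1,\dots,n\}$ is given by a set $E(G)$ of $3$-element subsets of $[n]$; its Lagrangian is $$\lambda(G)=\max\Big\{\sum_{ijk\in E(G)}x_ix_jx_k : x_1,\dots,x_n\ge 0,\ \sum_{i=1}^n x_i=1\Big\}.$$ Write $[t]^{(3)}$ for the complete $3$-graph on $[t]$. A clique of order $t$ in $G$ is a set of $t$ vertices all of whose $3$-element subsets are edges of $G$. $G$ is left-compressed if, whenever $j_1<j_2<j_3$ form an edge and $i_1<i_2<i_3$ satisfy $i_p\le j_p$ for $p=1,2,3$, then $i_1,i_2,i_3$ form an edge. **Lemma 3.1.** Let $m$ and $l$ be positive integers with $$\binom{l-1}{3}\le m\le\binom{l-1}{3}+\binom{l-2}{2},$$ where $\binom{a}{b}=0$ for $a<b$. Then at least one of the following holds. 1. There is a left-compressed $3$-graph $G$ on the vertex set $[l]$ with $m$ edges and without a clique of order $l-1$ such that $\lambda(G)=\lambda^-_{(m,l-1)}$, where $$\lambda^-_{(m,l-1)}=\max\{\lambda(G') : G' \text{ is a } 3\text{-graph on } [n] \text{ for some } n,\text{ with } m \text{ edges and without a clique of order } l-1\}$$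 (in particular, this maximum exists). 2. The Peng–Zhao conjecture holds for $r=3$ and these $m$ and $l$: every $3$-graph $G'$ with $m$ edges and without a clique of order $l-1$ (on $[n]$, for any $n$) satisfies $\lambda(G')<\lambda([l-1]^{(3)})$. -/

import Mathlib

/-- An `r`-uniform graph whose vertex set is the `n`-element ordered set `Fin n`
(standing for `[n] = {1, …, n}`, with `i : Fin n` in the role of `i + 1`). -/
@[ext]
structure RGraph (r n : ℕ) where
  /-- the edge set -/
  edges : Finset (Finset (Fin n))
  /-- every edge has exactly `r` vertices -/
  card_of_mem : ∀ e ∈ edges, e.card = r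

namespace RGraph

/-- The complete `r`-graph `[n]^{(r)}`. -/
def complete (r n : ℕ) : RGraph r n where
  edges := Finset.powersetCard r Finset.univ
  card_of_mem _ he := (Finset.mem_powersetCard.mp he).2

variable {r n : ℕ}

/-- `G` contains a clique of order `t`: some `t` vertices span all their `r`-subsets. -/
def HasClique (G : RGraph r n) (t : ℕ) : Prop :=
  ∃ S : Finset (Fin n), S.card = t ∧ Finset.powersetCard r S ⊆ G.edges

/-- `λ(G, x)`, the sum over the edges of the products of the weights of their vertices. -/
def weight (G : RGraph r n) (x : Fin n → ℝ) : ℝ :=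
  ∑ e ∈ G.edges, ∏ i ∈ e, x i

/-- The Lagrangian `λ(G)`: the maximum of `λ(G, x)` over the standard simplex.
For `n ≥ 1` the supremum is attained, see `isGreatest_lagrangian`. -/
noncomputable def lagrangian (G : RGraph r n) : ℝ :=
  sSup (G.weight '' stdSimplex ℝ (Fin n))

theorem isGreatest_lagrangian (G : RGraph r n) (hn : 0 < n) :
    IsGreatest (G.weight '' stdSimplex ℝ (Fin n)) G.lagrangian := by
  have hc : IsCompact (G.weight '' stdSimplex ℝ (Fin n)) := by
    refine (isCompact_stdSimplex ℝ (Fin n)).image ?_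
    unfold weight
    fun_prop
  have hne : (G.weight '' stdSimplex ℝ (Fin n)).Nonempty :=
    ⟨_, _, single_mem_stdSimplex ℝ (⟨0, hn⟩ : Fin n), rfl⟩
  exact hc.isGreatest_sSup hne

/-- `G` is left-compressed: if `j₁ < ⋯ < j_r` form an edge and `i₁ < ⋯ < i_r` satisfy
`i_p ≤ j_p` for every `p`, then `i₁, …, i_r` form an edge. -/
def LeftCompressed (G : RGraph r n) : Prop :=
  ∀ i j : Fin r → Fin n, StrictMono i → StrictMono j → (∀ p, i p ≤ j p) →
    Finset.univ.image j ∈ G.edges → Finset.univ.image i ∈ G.edges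

/-- The set of all values `λ(G)`, where `G` is an `r`-graph (on any number of vertices) with
`m` edges and without a clique of order `t`. -/
def lagrangiansWithoutClique (r m t : ℕ) : Set ℝ :=
  {c | ∃ (n : ℕ) (G : RGraph r n), G.edges.card = m ∧ ¬ G.HasClique t ∧ G.lagrangian = c}

/-- The assertion of the Peng-Zhao conjecture for given `r`, `m` and `l`: every `r`-graph with
`m` edges and without a clique of order `l - 1` has Lagrangian smaller than that of
`[l-1]^{(r)}`. -/
def PengZhaoConjecture (r m l : ℕ) : Prop :=
  ∀ (n : ℕ) (G : RGraph r n), G.edges.card = m → ¬ G.HasClique (l - 1) →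
    G.lagrangian < (complete r (l - 1)).lagrangian

end RGraph

/-!
Suppose some clique-free `G` with `m` edges has `λ(G) ≥ λ([l-1]^{(3)})`. At an optimal weighting
every vertex of positive weight has a link of weight at least `3λ(G)`; comparing this with `m` and
with the largest weight shows that at most `l` vertices have positive weight. So `G` may be moved to
the vertex set `[l]`, with the weights decreasing and at most `m` edges.

It remains to rearrange the non-edges on `[l]` without increasing their total weight. As `G` has no
clique of order `l - 1`, every vertex is missed by some non-edge. If there are at least four
non-edges, this allows exchanging four of them for the four triples inside the last four vertices,
after which no `l - 1` vertices span a clique. Shifting the other non-edges to the right then makes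
the graph left-compressed. There are fewer than four non-edges only if `l = 4`, where a single edge
is a clique of order `l - 1`, or if `l = 5` and `m = 7`. In the latter case three triples inside the
last four vertices can be made non-edges, and the weight of the remaining seven triples is always
smaller than `1 / 16 ≤ λ([4]^{(3)})`.
-/

theorem exists_antitone_embedding {V α : Type*} [LinearOrder α] (f : V → α) {T : Finset V} {l : ℕ}
    (hT : T.card = l) : ∃ σ : Fin l ↪ V, Finset.univ.map σ = T ∧ Antitone (f ∘ σ) := by
  subst hT
  let g : Fin T.card → αᵒᵈ := fun i => OrderDual.toDual (f (T.equivFin.symm i))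
  let σ : Fin T.card ≃ T := (Tuple.sort g).trans T.equivFin.symm
  refine ⟨σ.toEmbedding.trans (Function.Embedding.subtype _), ?_, fun i j hij =>
    OrderDual.toDual_le_toDual.1 (Tuple.monotone_sort g hij)⟩
  rw [← Finset.map_map, Finset.map_univ_equiv, Finset.univ_eq_attach, Finset.attach_map_val]

theorem exists_superset_sum_le {α : Type*} [DecidableEq α] (w : α → ℝ) (τ : ℝ) {K R A B : Finset α}
    (hcard : K.card ≤ R.card) (hA : A ⊆ K \ R) (hB : B ⊆ R \ K) (hBA : B.card ≤ A.card)
    (hw : ∑ s ∈ A, (w s - τ) ≤ ∑ s ∈ B, (w s - τ)) (hK : ∀ s ∈ K \ R, s ∉ A → w s ≤ τ)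
    (hR : ∀ s ∈ R \ K, τ ≤ w s) :
    ∃ F, K ⊆ F ∧ F ⊆ R ∪ K ∧ F.card = R.card ∧ ∑ s ∈ F, w s ≤ ∑ s ∈ R, w s := by
  obtain ⟨Q, hBQ, hQR, hQ⟩ := Finset.exists_subsuperset_card_eq hB
    (hBA.trans (Finset.card_le_card hA)) (Finset.card_sdiff_le_card_sdiff_iff.2 hcard)
  have hsum : ∑ s ∈ K \ R, w s ≤ ∑ s ∈ Q, w s := by
    have hshift : ∑ s ∈ K \ R, (w s - τ) ≤ ∑ s ∈ Q, (w s - τ) :=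
      calc ∑ s ∈ K \ R, (w s - τ) ≤ ∑ s ∈ A, (w s - τ) := by
            rw [← Finset.sum_sdiff hA]
            refine add_le_of_nonpos_left (Finset.sum_nonpos fun s hs => ?_)
            rw [Finset.mem_sdiff] at hs
            exact sub_nonpos.2 (hK s hs.1 hs.2)
        _ ≤ ∑ s ∈ B, (w s - τ) := hw
        _ ≤ ∑ s ∈ Q, (w s - τ) := Finset.sum_le_sum_of_subset_of_nonneg hBQ fun s hs _ =>
            sub_nonneg.2 (hR s (hQR hs))
    simpa [Finset.sum_sub_distrib, hQ] using hshift
  have hQR' : Q ⊆ R := hQR.trans Finset.sdiff_subset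
  have hdisj : Disjoint (R \ Q) (K \ R) :=
    Finset.disjoint_sdiff.mono_left Finset.sdiff_subset
  refine ⟨(R \ Q) ∪ (K \ R), fun s hs => ?_, ?_, ?_, ?_⟩
  · by_cases hsR : s ∈ R
    · exact Finset.mem_union_left _ (Finset.mem_sdiff.2
        ⟨hsR, fun hsQ => (Finset.mem_sdiff.1 (hQR hsQ)).2 hs⟩)
    · exact Finset.mem_union_right _ (Finset.mem_sdiff.2 ⟨hs, hsR⟩)
  · exact Finset.union_subset_union Finset.sdiff_subset Finset.sdiff_subset
  · rw [Finset.card_union_of_disjoint hdisj, ← hQ, Finset.card_sdiff_add_card_eq_card hQR']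
  · rw [Finset.sum_union hdisj, ← Finset.sum_sdiff hQR']
    gcongr

/- If `f = g`, this element alone pays for both `p` and `q`, and an arbitrary element of `R \ K`
makes room for the second one. -/
theorem exists_superset_sum_le_of_pair {α : Type*} [DecidableEq α] (w : α → ℝ) (τ : ℝ)
    {K R : Finset α} (hcard : K.card ≤ R.card) {p q f g : α} (hp : p ∈ K) (hq : q ∈ K)
    (hpq : p ≠ q) (hf : f ∈ R) (hg : g ∈ R) (hfK : p ∉ R → f ∉ K) (hgK : q ∉ R → g ∉ K)
    (hpf : w p ≤ w f) (hqg : w q ≤ w g) (hfg : f = g → w p + w q ≤ w f + τ)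
    (hK : ∀ s ∈ K, s ≠ p → s ≠ q → w s ≤ τ) (hR : ∀ s ∈ R \ K, τ ≤ w s) :
    ∃ F, K ⊆ F ∧ F ⊆ R ∪ K ∧ F.card = R.card ∧ ∑ s ∈ F, w s ≤ ∑ s ∈ R, w s := by
  suffices h : ∃ A B : Finset α, A ⊆ K \ R ∧ B ⊆ R \ K ∧ B.card ≤ A.card ∧
      ∑ s ∈ A, (w s - τ) ≤ ∑ s ∈ B, (w s - τ) ∧ (p ∉ R → p ∈ A) ∧ (q ∉ R → q ∈ A) by
    obtain ⟨A, B, hA, hB, hBA, hsum, hpA, hqA⟩ := h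
    refine exists_superset_sum_le w τ hcard hA hB hBA hsum (fun s hs hsA => ?_) hR
    rw [Finset.mem_sdiff] at hs
    exact hK s hs.1 (fun h => hsA (h ▸ hpA (h ▸ hs.2))) (fun h => hsA (h ▸ hqA (h ▸ hs.2)))
  by_cases hpR : p ∈ R <;> by_cases hqR : q ∈ R
  · exact ⟨∅, ∅, by simp [hpR, hqR]⟩
  · exact ⟨{q}, {g}, by simp [hq, hg, hpR, hqR, hgK, hqg]⟩
  · exact ⟨{p}, {f}, by simp [hp, hf, hpR, hqR, hfK, hpf]⟩
  · have hA : {p, q} ⊆ K \ R := by simp [Finset.insert_subset_iff, hp, hq, hpR, hqR]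
    by_cases hfg' : f = g
    · refine ⟨{p, q}, {f}, hA, by simp [hf, hfK hpR], by simp [hpq], ?_, by simp, by simp⟩
      rw [Finset.sum_pair hpq, Finset.sum_singleton]
      linarith [hfg hfg']
    · refine ⟨{p, q}, {f, g}, hA, ?_, by simp [hpq, hfg'], ?_, by simp, by simp⟩
      · simp [Finset.insert_subset_iff, hf, hg, hfK hpR, hgK hqR]
      · rw [Finset.sum_pair hpq, Finset.sum_pair hfg']
        gcongr

theorem sum_powersetCard_succ_insert {ι R : Type*} [DecidableEq ι] [CommSemiring R] {a : ι}
    {S : Finset ι} (ha : a ∉ S) (k : ℕ) (y : ι → R) :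
    ∑ e ∈ (insert a S).powersetCard (k + 1), ∏ i ∈ e, y i =
      ∑ e ∈ S.powersetCard (k + 1), ∏ i ∈ e, y i + y a * ∑ e ∈ S.powersetCard k, ∏ i ∈ e, y i := by
  have notMem {j : ℕ} {e : Finset ι} (he : e ∈ S.powersetCard j) : a ∉ e := fun h =>
    ha ((Finset.mem_powersetCard.1 he).1 h)
  rw [Finset.powersetCard_succ_insert ha, Finset.sum_union, Finset.sum_image, Finset.mul_sum]
  · congr 1
    exact Finset.sum_congr rfl fun e he => Finset.prod_insert (notMem he)
  · intro e he f hf hef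
    rw [← Finset.erase_insert (notMem he), hef, Finset.erase_insert (notMem hf)]
  · rw [Finset.disjoint_left]
    intro e he he'
    obtain ⟨f, -, rfl⟩ := Finset.mem_image.1 he'
    exact notMem he (Finset.mem_insert_self a f)

theorem two_mul_sum_powersetCard_two {ι R : Type*} [CommRing R] (S : Finset ι) (y : ι → R) :
    2 * ∑ e ∈ S.powersetCard 2, ∏ i ∈ e, y i = (∑ i ∈ S, y i) ^ 2 - ∑ i ∈ S, y i ^ 2 := by
  classical
  induction S using Finset.induction_on with
  | empty =>
    rw [Finset.powersetCard_eq_empty.2 (by simp)]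
    simp
  | insert a S ha ih =>
    rw [sum_powersetCard_succ_insert ha, mul_add, ih, Finset.sum_insert ha, Finset.sum_insert ha,
      Finset.powersetCard_one, Finset.sum_map]
    simp only [Function.Embedding.coeFn_mk, Finset.prod_singleton]
    ring

theorem two_mul_card_mul_sum_powersetCard_two_le {ι : Type*} (S : Finset ι) (y : ι → ℝ) :
    2 * S.card * ∑ e ∈ S.powersetCard 2, ∏ i ∈ e, y i ≤ (S.card - 1) * (∑ i ∈ S, y i) ^ 2 := by
  have cauchySchwarz : (∑ i ∈ S, y i) ^ 2 ≤ S.card * ∑ i ∈ S, y i ^ 2 := sq_sum_le_card_mul_sum_sq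
  linear_combination S.card * two_mul_sum_powersetCard_two S y + cauchySchwarz

theorem mul_sum_pairs_sub_le {a b c M : ℝ} (ha : 0 ≤ a) (hb : 0 ≤ b) (hc : 0 ≤ c) (haM : a ≤ M)
    (hbM : b ≤ M) (hcM : c ≤ M) : M * (a * b + b * c + c * a) - 2 * (a * b * c) ≤ M ^ 3 := by
  rw [← sub_nonneg] at haM hbM hcM
  have h : 0 ≤ (M - a) * (M - b) * (M - c) + a * ((M - b) * (M - c)) + b * ((M - a) * (M - c)) +
      c * ((M - a) * (M - b)) := by positivity
  linear_combination h

theorem sum_mul_prod_erase_le {ι : Type*} [DecidableEq ι] {e : Finset ι} (he : e.card = 3)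
    {x : ι → ℝ} {M : ℝ} (hx : ∀ i, 0 ≤ x i) (hM : ∀ i, x i ≤ M) :
    ∑ v ∈ e, (3 * M - 2 * x v) * ∏ i ∈ e.erase v, x i ≤ 3 * M ^ 3 := by
  obtain ⟨a, b, c, hab, hac, hbc, rfl⟩ := Finset.card_eq_three.1 he
  have h := mul_sum_pairs_sub_le (hx a) (hx b) (hx c) (hM a) (hM b) (hM c)
  have hexpand : ∑ v ∈ {a, b, c}, (3 * M - 2 * x v) * ∏ i ∈ ({a, b, c} : Finset ι).erase v, x i =
      (3 * M - 2 * x a) * (x b * x c) + (3 * M - 2 * x b) * (x a * x c) +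
        (3 * M - 2 * x c) * (x a * x b) := by
    simp [Finset.erase_insert_eq_erase, Finset.erase_insert_of_ne, hab, hac, hbc,
      add_assoc]
  rw [hexpand]
  linear_combination 3 * h

/-- The set of indices at which the weighting `x` is positive. -/
noncomputable def posSupport {ι : Type*} [Fintype ι] (x : ι → ℝ) : Finset ι := {i | 0 < x i}

theorem mem_posSupport {ι : Type*} [Fintype ι] {x : ι → ℝ} {i : ι} :
    i ∈ posSupport x ↔ 0 < x i := by
  simp [posSupport]

theorem eq_zero_of_notMem_posSupport {ι : Type*} [Fintype ι] {x : ι → ℝ} (hx : ∀ i, 0 ≤ x i)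
    {i : ι} (hi : i ∉ posSupport x) : x i = 0 :=
  (not_lt.1 (mt mem_posSupport.2 hi)).antisymm (hx i)

theorem sum_posSupport {ι : Type*} [Fintype ι] {x : ι → ℝ} (hx : ∀ i, 0 ≤ x i) :
    ∑ i ∈ posSupport x, x i = ∑ i, x i :=
  Finset.sum_subset (Finset.subset_univ _) fun _ _ hi => eq_zero_of_notMem_posSupport hx hi

namespace RGraph

section Lagrangian

variable {r n : ℕ} (G : RGraph r n) {x : Fin n → ℝ}

theorem weight_smul (c : ℝ) (x : Fin n → ℝ) : G.weight (c • x) = c ^ r * G.weight x := by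
  unfold weight
  rw [Finset.mul_sum]
  refine Finset.sum_congr rfl fun e he => ?_
  simp [Finset.prod_mul_distrib, G.card_of_mem e he]

theorem weight_le_lagrangian (hx : x ∈ stdSimplex ℝ (Fin n)) : G.weight x ≤ G.lagrangian := by
  have hn : 0 < n := Nat.pos_of_ne_zero fun h => by
    subst h
    simpa using hx.2
  exact (G.isGreatest_lagrangian hn).2 ⟨x, hx, rfl⟩

theorem weight_le_sum_pow_mul_lagrangian (hx : ∀ i, 0 ≤ x i) (hs : 0 < ∑ i, x i) :
    G.weight x ≤ (∑ i, x i) ^ r * G.lagrangian := by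
  have hmem : (∑ i, x i)⁻¹ • x ∈ stdSimplex ℝ (Fin n) := by
    refine ⟨fun i => mul_nonneg (inv_nonneg.2 hs.le) (hx i), ?_⟩
    simp only [Pi.smul_apply, smul_eq_mul, ← Finset.mul_sum, inv_mul_cancel₀ hs.ne']
  have h := G.weight_le_lagrangian hmem
  rwa [weight_smul, inv_pow, inv_mul_le_iff₀ (by positivity)] at h

theorem exists_weight_eq_lagrangian (hr : 0 < r) (hG : 0 < G.edges.card) :
    ∃ x ∈ stdSimplex ℝ (Fin n), G.weight x = G.lagrangian := by
  obtain ⟨e, he⟩ := Finset.card_pos.1 hG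
  have hn : r ≤ n := G.card_of_mem e he ▸ card_finset_fin_le e
  exact (G.isGreatest_lagrangian (hr.trans_le hn)).1

theorem choose_le_pow_mul_lagrangian_complete {q : ℕ} (hq : 0 < q) :
    (q.choose r : ℝ) ≤ q ^ r * (complete r q).lagrangian := by
  have h := (complete r q).weight_le_sum_pow_mul_lagrangian (x := 1) (by simp) (by simpa using hq)
  simpa [weight, complete] using h

/-- The weight of the link of `v`, which is the partial derivative of `G.weight` in the direction
of `v`. -/
def linkWeight (x : Fin n → ℝ) (v : Fin n) : ℝ :=
  ∑ e ∈ G.edges with v ∈ e, ∏ i ∈ e.erase v, x i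

theorem weight_update_sub (x : Fin n → ℝ) (v : Fin n) (t : ℝ) :
    G.weight (Function.update x v (x v - t)) = G.weight x - t * G.linkWeight x v := by
  unfold weight linkWeight
  rw [Finset.mul_sum, Finset.sum_filter, ← Finset.sum_sub_distrib]
  refine Finset.sum_congr rfl fun e _ => ?_
  split_ifs with hv
  · rw [Finset.prod_update_of_mem hv, ← Finset.mul_prod_erase e x hv,
      Finset.sdiff_singleton_eq_erase]
    ring
  · rw [Finset.prod_update_of_notMem hv, sub_zero]

theorem mul_lagrangian_le_linkWeight (hx : x ∈ stdSimplex ℝ (Fin n))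
    (hopt : G.weight x = G.lagrangian) {v : Fin n} (hv : 0 < x v) :
    r * G.lagrangian ≤ G.linkWeight x v := by
  have decrease_weight : ∀ t ∈ Set.Ioo 0 (min (x v) 1),
      (∑ k ∈ Finset.range r, (1 - t) ^ k) * G.lagrangian ≤ G.linkWeight x v := by
    rintro t ⟨ht0, ht⟩
    rw [lt_min_iff] at ht
    have hnonneg : ∀ i, 0 ≤ Function.update x v (x v - t) i :=
      le_update_iff.2 ⟨sub_nonneg.2 ht.1.le, fun i _ => hx.1 i⟩
    have hsum : ∑ i, Function.update x v (x v - t) i = 1 - t := by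
      rw [Finset.sum_update_of_mem (Finset.mem_univ v), ← hx.2,
        ← Finset.add_sum_erase _ _ (Finset.mem_univ v), Finset.sdiff_singleton_eq_erase]
      ring
    have h := G.weight_le_sum_pow_mul_lagrangian hnonneg (by linarith)
    rw [hsum, weight_update_sub, hopt] at h
    refine le_of_mul_le_mul_left ?_ ht0
    linear_combination h + G.lagrangian * mul_neg_geom_sum (1 - t) r
  have hlim : Filter.Tendsto (fun t : ℝ => (∑ k ∈ Finset.range r, (1 - t) ^ k) * G.lagrangian)
      (nhdsWithin 0 (Set.Ioi 0)) (nhds (r * G.lagrangian)) := by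
    have hcont : Continuous fun t : ℝ =>
        (∑ k ∈ Finset.range r, (1 - t) ^ k) * G.lagrangian := by fun_prop
    simpa using (hcont.tendsto 0).mono_left nhdsWithin_le_nhds
  exact le_of_tendsto hlim
    (Filter.mem_of_superset (Ioo_mem_nhdsGT (lt_min hv one_pos)) decrease_weight)

theorem sum_mul_linkWeight (c x : Fin n → ℝ) :
    ∑ v, c v * G.linkWeight x v = ∑ e ∈ G.edges, ∑ v ∈ e, c v * ∏ i ∈ e.erase v, x i := by
  simp only [linkWeight, Finset.mul_sum]
  exact Finset.sum_comm' fun v e => by simp [and_comm]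

theorem linkWeight_nonneg (hx : ∀ i, 0 ≤ x i) (v : Fin n) : 0 ≤ G.linkWeight x v :=
  Finset.sum_nonneg fun _ _ => Finset.prod_nonneg fun i _ => hx i

theorem linkWeight_le_sum_powersetCard (hx : ∀ i, 0 ≤ x i) (v : Fin n) :
    G.linkWeight x v ≤
      ∑ p ∈ ((posSupport x).erase v).powersetCard (r - 1), ∏ i ∈ p, x i := by
  have herase : Set.InjOn (fun e : Finset (Fin n) => e.erase v)
      (G.edges.filter (v ∈ ·) : Finset (Finset (Fin n))) :=
    (Finset.erase_injOn' v).mono fun e he => (Finset.mem_filter.1 he).2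
  rw [linkWeight, ← Finset.sum_image (f := fun p => ∏ i ∈ p, x i) herase,
    ← Finset.sum_filter_ne_zero]
  refine Finset.sum_le_sum_of_subset_of_nonneg (fun p hp => ?_) fun p _ _ =>
    Finset.prod_nonneg fun i _ => hx i
  simp only [Finset.mem_filter, Finset.mem_image] at hp
  obtain ⟨⟨e, ⟨he, hve⟩, rfl⟩, hne⟩ := hp
  rw [Finset.mem_powersetCard, Finset.card_erase_of_mem hve, G.card_of_mem e he]
  refine ⟨fun i hi => Finset.mem_erase.2 ⟨Finset.ne_of_mem_erase hi, ?_⟩, rfl⟩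
  by_contra hi0
  exact hne (Finset.prod_eq_zero hi (eq_zero_of_notMem_posSupport hx hi0))

end Lagrangian

section SupportBound

variable {n : ℕ} (G : RGraph 3 n) {x : Fin n → ℝ}

/- Each positive vertex has link weight at least `3 * λ`; weighting it by `3 * M - 2 * x v` is what
makes the contribution of a single edge at most `3 * M ^ 3`. -/
theorem lagrangian_mul_le_card_mul_pow (hx : x ∈ stdSimplex ℝ (Fin n))
    (hopt : G.weight x = G.lagrangian) {M : ℝ} (hM : ∀ i, x i ≤ M) :
    G.lagrangian * (3 * (posSupport x).card * M - 2) ≤ G.edges.card * M ^ 3 := by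
  have hcoeff (v : Fin n) : 0 ≤ 3 * M - 2 * x v := by linarith [hx.1 v, hM v]
  have hsum : ∑ v ∈ posSupport x, (3 * M - 2 * x v) = 3 * (posSupport x).card * M - 2 := by
    rw [Finset.sum_sub_distrib, ← Finset.mul_sum _ x, sum_posSupport hx.1, hx.2, Finset.sum_const,
      nsmul_eq_mul]
    ring
  have key : (3 * (posSupport x).card * M - 2) * (3 * G.lagrangian) ≤
      G.edges.card * (3 * M ^ 3) :=
    calc (3 * (posSupport x).card * M - 2) * (3 * G.lagrangian)
        = ∑ v ∈ posSupport x, (3 * M - 2 * x v) * (3 * G.lagrangian) := by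
          rw [← hsum, Finset.sum_mul]
      _ ≤ ∑ v ∈ posSupport x, (3 * M - 2 * x v) * G.linkWeight x v :=
          Finset.sum_le_sum fun v hv => mul_le_mul_of_nonneg_left
            (mod_cast G.mul_lagrangian_le_linkWeight hx hopt (mem_posSupport.1 hv)) (hcoeff v)
      _ ≤ ∑ v, (3 * M - 2 * x v) * G.linkWeight x v :=
          Finset.sum_le_sum_of_subset_of_nonneg (Finset.subset_univ _) fun v _ _ =>
            mul_nonneg (hcoeff v) (G.linkWeight_nonneg hx.1 v)
      _ = ∑ e ∈ G.edges, ∑ v ∈ e, (3 * M - 2 * x v) * ∏ i ∈ e.erase v, x i :=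
          G.sum_mul_linkWeight _ x
      _ ≤ ∑ _e ∈ G.edges, 3 * M ^ 3 :=
          Finset.sum_le_sum fun e he => sum_mul_prod_erase_le (G.card_of_mem e he) hx.1 hM
      _ = G.edges.card * (3 * M ^ 3) := by rw [Finset.sum_const, nsmul_eq_mul]
  linear_combination key / 3

theorem two_mul_linkWeight_le (hx : x ∈ stdSimplex ℝ (Fin n)) {v : Fin n} (hv : 0 < x v) :
    2 * ((posSupport x).card - 1) * G.linkWeight x v ≤
      ((posSupport x).card - 2) * (1 - x v) ^ 2 := by
  have hmem : v ∈ posSupport x := mem_posSupport.2 hv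
  have hsum : ∑ i ∈ (posSupport x).erase v, x i = 1 - x v := by
    rw [← hx.2, ← sum_posSupport hx.1, ← Finset.add_sum_erase _ x hmem, add_sub_cancel_left]
  have hcard : (((posSupport x).erase v).card : ℝ) = (posSupport x).card - 1 := by
    rw [Finset.cast_card_erase_of_mem hmem]
  have h := two_mul_card_mul_sum_powersetCard_two_le ((posSupport x).erase v) x
  rw [hsum, hcard] at h
  have hcard_pos : (0 : ℝ) ≤ (posSupport x).card - 1 := hcard ▸ Nat.cast_nonneg _
  have hlink := mul_le_mul_of_nonneg_left (G.linkWeight_le_sum_powersetCard hx.1 v) hcard_pos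
  linear_combination 2 * hlink + h

theorem one_le_of_support_cubic {q k T : ℝ} (hq : 0 ≤ q) (hk : q + 2 ≤ k) (hT : 0 < T)
    (hkT : q ≤ k * T) (hcubic : 3 * k * T - 2 * q ≤ (q + 3) * T ^ 3) : 1 ≤ T := by
  by_contra! hT1
  have hk' : k ≤ (q + 3) * T ^ 2 := le_of_mul_le_mul_left (by linarith) hT
  have hdev : (q + 3) * (1 - T) ≤ 1 := by
    have : 0 ≤ (q + 3) * (1 - T) * T :=
      mul_nonneg (mul_nonneg (by linarith) (by linarith)) hT.le
    linarith
  have hkT' : (q + 2) * T ≤ k * T := mul_le_mul_of_nonneg_right hk hT.le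
  have hdev' := mul_le_mul_of_nonneg_right hdev
    (show 0 ≤ (1 - T) * (T + 2) from mul_nonneg (by linarith) (by linarith))
  linarith [sq_nonneg (1 - T)]

theorem mul_le_of_support_quadratic {s j δ : ℝ} (hs : 3 ≤ s) (hj : 1 ≤ j) (hδ : 0 ≤ δ)
    (hδs : δ ≤ s) (hquad : δ * (2 * s - δ) * (s + j) ≤ s * (1 + j)) :
    δ ≤ 3 / 5 ∧ 9 / 5 * (δ * (s + j)) ≤ 1 + j := by
  have hs0 : 0 < s := by linarith
  have hsj : 0 < s + j := by linarith
  have hprod : δ * (2 * s - δ) ≤ s := by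
    refine le_of_mul_le_mul_right (hquad.trans ?_) hsj
    gcongr
    linarith
  have hδ1 : δ ≤ 1 := by
    refine le_of_mul_le_mul_right ?_ hs0
    linarith [mul_nonneg hδ (sub_nonneg.2 hδs)]
  have hδ35 : δ ≤ 3 / 5 := by
    refine le_of_mul_le_mul_right (a := 2 * s - 1) ?_ (by linarith)
    linarith [mul_nonneg hδ (sub_nonneg.2 hδ1)]
  refine ⟨hδ35, le_of_mul_le_mul_left (hquad.trans' ?_) hs0⟩
  have : 0 ≤ δ * (s + j) * (s / 5 - δ) := by
    have : 0 ≤ s / 5 - δ := by linarith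
    positivity
  linarith

theorem lt_add_two_of_support_bounds {q k T : ℝ} (hq : 4 ≤ q) (hT : 0 < T) (hTq : T ≤ q)
    (hkT : q ≤ k * T) (hcubic : 3 * k * T - 2 * q ≤ (q + 3) * T ^ 3)
    (hquad : (q - 1) * (q - 2) * (k - 1) ≤ (k - 2) * (q - T) ^ 2) : k < q + 2 := by
  by_contra! hk
  have hT1 : 1 ≤ T := one_le_of_support_cubic (by linarith) hk hT hkT hcubic
  obtain ⟨δ, rfl⟩ : ∃ δ, T = 1 + δ := ⟨T - 1, by ring⟩
  obtain ⟨s, rfl⟩ : ∃ s, q = s + 1 := ⟨q - 1, by ring⟩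
  obtain ⟨j, rfl⟩ : ∃ j, k = s + 2 + j := ⟨k - s - 2, by ring⟩
  have hs : 3 ≤ s := by linarith
  have hj : 1 ≤ j := by linarith
  have hδ : 0 ≤ δ := by linarith
  obtain ⟨hδ35, hδsj⟩ : δ ≤ 3 / 5 ∧ 9 / 5 * (δ * (s + j)) ≤ 1 + j :=
    mul_le_of_support_quadratic hs hj hδ (by linarith) (by linear_combination hquad)
  have hδs : δ * (s + 4) ≤ 35 / 36 * (1 + j) := by
    have : δ * (s + 4) ≤ δ * (7 / 4 * (s + j)) := by gcongr; linarith
    linarith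
  have hδj : δ * (3 + j) ≤ 5 / 9 * (1 + j) := by
    have : δ * (3 + j) ≤ δ * (s + j) := by gcongr
    linarith
  have hj_le : 3 * j ≤ (19 + j) / 2 * δ := by
    have : δ * (s + 4) * (δ * (3 + δ)) ≤ 35 / 36 * (1 + j) * (δ * (18 / 5)) := by
      gcongr
      linarith
    linear_combination hcubic + this
  have : 3 * j * (3 + j) ≤ (19 + j) / 2 * (5 / 9 * (1 + j)) :=
    calc 3 * j * (3 + j) ≤ (19 + j) / 2 * δ * (3 + j) := by gcongr
      _ = (19 + j) / 2 * (δ * (3 + j)) := by ring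
      _ ≤ (19 + j) / 2 * (5 / 9 * (1 + j)) := by gcongr
  nlinarith

theorem six_mul_choose_three_cast (q : ℕ) : 6 * (q.choose 3 : ℝ) = q * (q - 1) * (q - 2) := by
  induction q with
  | zero => simp
  | succ q ih =>
    rw [Nat.choose_succ_succ' q 2, Nat.cast_add, Nat.cast_choose_two, Nat.cast_succ]
    linear_combination ih

theorem mul_le_lagrangian_complete_three {q : ℕ} (hq : 0 < q) :
    ((q : ℝ) - 1) * (q - 2) ≤ 6 * q ^ 2 * (complete 3 q).lagrangian := by
  have h := choose_le_pow_mul_lagrangian_complete (r := 3) hq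
  refine le_of_mul_le_mul_left ?_ (Nat.cast_pos.2 hq)
  linear_combination 6 * h - six_mul_choose_three_cast q

theorem six_mul_cast_le_of_le_choose {m q : ℕ} (hq : 0 < q)
    (hm : m ≤ q.choose 3 + (q - 1).choose 2) :
    6 * (m : ℝ) ≤ (q - 1) * (q - 2) * (q + 3) := by
  have hm' : (m : ℝ) ≤ q.choose 3 + (q - 1).choose 2 := mod_cast hm
  rw [Nat.cast_choose_two, Nat.cast_pred hq] at hm'
  linear_combination 6 * hm' + six_mul_choose_three_cast q

theorem card_posSupport_cubic_le {q : ℕ} (hq : 2 < q)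
    (hm : G.edges.card ≤ q.choose 3 + (q - 1).choose 2)
    (hL : (complete 3 q).lagrangian ≤ G.lagrangian) (hx : x ∈ stdSimplex ℝ (Fin n))
    (hopt : G.weight x = G.lagrangian) {M : ℝ} (hM : ∀ i, x i ≤ M)
    (hcard : 1 ≤ (posSupport x).card * M) :
    3 * (posSupport x).card * (q * M) - 2 * q ≤ (q + 3) * (q * M) ^ 3 := by
  set k : ℝ := ((posSupport x).card : ℝ)
  have hq' : (2 : ℝ) < q := mod_cast hq
  have hM0 : 0 < M := pos_of_mul_pos_right (one_pos.trans_le hcard) (Nat.cast_nonneg _)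
  have hlam := (mul_le_lagrangian_complete_three (by omega)).trans
    (mul_le_mul_of_nonneg_left hL (by positivity : (0 : ℝ) ≤ 6 * q ^ 2))
  have hq12 : 0 < ((q : ℝ) - 1) * (q - 2) := mul_pos (by linarith) (by linarith)
  refine le_of_mul_le_mul_left ?_ hq12
  calc ((q : ℝ) - 1) * (q - 2) * (3 * k * (q * M) - 2 * q)
      = (q - 1) * (q - 2) * (q * (3 * k * M - 2)) := by ring
    _ ≤ 6 * q ^ 2 * G.lagrangian * (q * (3 * k * M - 2)) := by
        gcongr
        exact mul_nonneg (by linarith) (by linarith)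
    _ = 6 * q ^ 3 * (G.lagrangian * (3 * k * M - 2)) := by ring
    _ ≤ 6 * q ^ 3 * (G.edges.card * M ^ 3) :=
        mul_le_mul_of_nonneg_left (G.lagrangian_mul_le_card_mul_pow hx hopt hM) (by positivity)
    _ = 6 * G.edges.card * (q * M) ^ 3 := by ring
    _ ≤ (q - 1) * (q - 2) * (q + 3) * (q * M) ^ 3 :=
        mul_le_mul_of_nonneg_right (six_mul_cast_le_of_le_choose (by omega) hm) (by positivity)
    _ = (q - 1) * (q - 2) * ((q + 3) * (q * M) ^ 3) := by ring

theorem card_posSupport_quadratic_le {q : ℕ} (hq : 0 < q)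
    (hL : (complete 3 q).lagrangian ≤ G.lagrangian) (hx : x ∈ stdSimplex ℝ (Fin n))
    (hopt : G.weight x = G.lagrangian) {v : Fin n} (hv : 0 < x v) :
    ((q : ℝ) - 1) * (q - 2) * ((posSupport x).card - 1) ≤
      ((posSupport x).card - 2) * (q - q * x v) ^ 2 := by
  set k : ℝ := ((posSupport x).card : ℝ)
  have hk : 0 ≤ k - 1 := by
    rw [sub_nonneg, Nat.one_le_cast, Nat.one_le_iff_ne_zero, Finset.card_ne_zero]
    exact ⟨v, mem_posSupport.2 hv⟩
  have hlam := (mul_le_lagrangian_complete_three hq).trans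
    (mul_le_mul_of_nonneg_left hL (by positivity))
  have hlink : 3 * G.lagrangian ≤ G.linkWeight x v := G.mul_lagrangian_le_linkWeight hx hopt hv
  calc ((q : ℝ) - 1) * (q - 2) * (k - 1)
      ≤ 6 * q ^ 2 * G.lagrangian * (k - 1) := mul_le_mul_of_nonneg_right hlam hk
    _ = q ^ 2 * (2 * (k - 1) * (3 * G.lagrangian)) := by ring
    _ ≤ q ^ 2 * (2 * (k - 1) * G.linkWeight x v) := by gcongr
    _ ≤ q ^ 2 * ((k - 2) * (1 - x v) ^ 2) :=
        mul_le_mul_of_nonneg_left (G.two_mul_linkWeight_le hx hv) (by positivity)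
    _ = (k - 2) * (q - q * x v) ^ 2 := by ring

theorem card_posSupport_le {q : ℕ} (hq : 4 ≤ q)
    (hm : G.edges.card ≤ q.choose 3 + (q - 1).choose 2)
    (hL : (complete 3 q).lagrangian ≤ G.lagrangian) (hx : x ∈ stdSimplex ℝ (Fin n))
    (hopt : G.weight x = G.lagrangian) : (posSupport x).card ≤ q + 1 := by
  have hq' : (4 : ℝ) ≤ q := mod_cast hq
  have : Nonempty (Fin n) := by
    by_contra hn
    rw [not_nonempty_iff] at hn
    simpa using hx.2
  obtain ⟨v, hv⟩ := Finite.exists_max x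
  have hcard : 1 ≤ (posSupport x).card * x v := by
    rw [← hx.2, ← sum_posSupport hx.1, ← nsmul_eq_mul]
    exact Finset.sum_le_card_nsmul _ _ _ fun i _ => hv i
  have hv0 : 0 < x v := pos_of_mul_pos_right (one_pos.trans_le hcard) (Nat.cast_nonneg _)
  have hv1 : x v ≤ 1 := hx.2 ▸ Finset.single_le_sum (fun i _ => hx.1 i) (Finset.mem_univ v)
  have hlt : ((posSupport x).card : ℝ) < q + 2 :=
    lt_add_two_of_support_bounds hq' (by positivity) (mul_le_of_le_one_right (by linarith) hv1)
      (by linear_combination (q : ℝ) * hcard)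
      (G.card_posSupport_cubic_le (by omega) hm hL hx hopt hv hcard)
      (G.card_posSupport_quadratic_le (by omega) hL hx hopt hv0)
  have : (posSupport x).card < q + 2 := by exact_mod_cast hlt
  omega

end SupportBound

section Transport

variable {r n k : ℕ}

/-- The complementary `r`-graph, whose edges are the `r`-subsets that are not edges of `G`. -/
def compl (G : RGraph r n) : RGraph r n where
  edges := Finset.powersetCard r Finset.univ \ G.edges
  card_of_mem _ he := (Finset.mem_powersetCard.1 (Finset.mem_sdiff.1 he).1).2

/-- The image of `G` under an embedding of its vertex set, which may add isolated vertices. -/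
def map (G : RGraph r n) (f : Fin n ↪ Fin k) : RGraph r k where
  edges := G.edges.map (Finset.mapEmbedding f).toEmbedding
  card_of_mem := by
    simpa using fun e he => G.card_of_mem e he

/-- The subgraph of `G` induced on the range of an embedding, with its vertices relabelled. -/
def comap (G : RGraph r k) (f : Fin n ↪ Fin k) : RGraph r n where
  edges := {e | e.map f ∈ G.edges}
  card_of_mem e he := by
    rw [← Finset.card_map f, G.card_of_mem _ (Finset.mem_filter.1 he).2]

theorem mem_edges_compl {G : RGraph r n} {e : Finset (Fin n)} :
    e ∈ G.compl.edges ↔ e.card = r ∧ e ∉ G.edges := by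
  simp [compl]

theorem map_mem_edges_map {G : RGraph r n} {f : Fin n ↪ Fin k} {e : Finset (Fin n)} :
    e.map f ∈ (G.map f).edges ↔ e ∈ G.edges := by
  simp [map]

theorem mem_edges_comap {G : RGraph r k} {f : Fin n ↪ Fin k} {e : Finset (Fin n)} :
    e ∈ (G.comap f).edges ↔ e.map f ∈ G.edges := by
  simp [comap]

theorem edges_subset_powersetCard (G : RGraph r n) :
    G.edges ⊆ Finset.powersetCard r Finset.univ := fun e he =>
  Finset.mem_powersetCard.2 ⟨Finset.subset_univ e, G.card_of_mem e he⟩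

theorem card_compl_add_card (G : RGraph r n) :
    G.compl.edges.card + G.edges.card = n.choose r := by
  simpa [compl] using Finset.card_sdiff_add_card_eq_card G.edges_subset_powersetCard

theorem weight_compl_add_weight (G : RGraph r n) (y : Fin n → ℝ) :
    G.compl.weight y + G.weight y = (complete r n).weight y :=
  Finset.sum_sdiff G.edges_subset_powersetCard

theorem exists_notMem_compl_of_not_hasClique (G : RGraph r n) (hG : ¬ G.HasClique (n - 1))
    (v : Fin n) : ∃ e ∈ G.compl.edges, v ∉ e := by
  by_contra! h
  refine hG ⟨Finset.univ.erase v, by simp, fun e he => ?_⟩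
  rw [Finset.mem_powersetCard] at he
  by_contra heG
  exact Finset.notMem_erase v _ (he.1 (h e (mem_edges_compl.2 ⟨he.2, heG⟩)))

theorem not_hasClique_compl {F : RGraph r n} {S : Finset (Fin n)}
    (hS : Finset.powersetCard r S ⊆ F.edges) {t : ℕ} (ht : n + r ≤ S.card + t) :
    ¬ F.compl.HasClique t := by
  rintro ⟨Q, rfl, hQ⟩
  have hcard : r ≤ (S ∩ Q).card := by
    have := Finset.card_union_add_card_inter S Q
    have := card_finset_fin_le (S ∪ Q)
    omega
  obtain ⟨e, he, her⟩ := Finset.exists_subset_card_eq hcard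
  rw [Finset.subset_inter_iff] at he
  exact (mem_edges_compl.1 (hQ (Finset.mem_powersetCard.2 ⟨he.2, her⟩))).2
    (hS (Finset.mem_powersetCard.2 ⟨he.1, her⟩))

theorem weight_map (G : RGraph r n) (f : Fin n ↪ Fin k) (x : Fin k → ℝ) :
    (G.map f).weight x = G.weight (x ∘ f) := by
  simp [weight, map]

theorem weight_comap (G : RGraph r k) (f : Fin n ↪ Fin k) {x : Fin k → ℝ}
    (hx : ∀ i ∉ Finset.univ.map f, x i = 0) : (G.comap f).weight (x ∘ f) = G.weight x := by
  rw [← weight_map]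
  refine Finset.sum_subset (fun e he => ?_) fun e he hef => ?_
  · obtain ⟨e, -, rfl⟩ := Finset.mem_map.1 he
    exact mem_edges_comap.1 (map_mem_edges_map.1 he)
  · have hnot : ¬ e ⊆ Finset.univ.map f := fun h => by
      obtain ⟨e, -, rfl⟩ := Finset.subset_map_iff.1 h
      exact hef (map_mem_edges_map.2 (mem_edges_comap.2 he))
    obtain ⟨i, hie, hi⟩ := Finset.not_subset.1 hnot
    exact Finset.prod_eq_zero hie (hx i hi)

theorem card_edges_map (G : RGraph r n) (f : Fin n ↪ Fin k) :
    (G.map f).edges.card = G.edges.card :=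
  Finset.card_map _

theorem card_edges_comap_le (G : RGraph r k) (f : Fin n ↪ Fin k) :
    (G.comap f).edges.card ≤ G.edges.card :=
  Finset.card_le_card_of_injOn (·.map f) (fun _ he => mem_edges_comap.1 he)
    (Finset.map_injective f).injOn

theorem HasClique.of_comap {G : RGraph r k} {f : Fin n ↪ Fin k} {t : ℕ}
    (h : (G.comap f).HasClique t) : G.HasClique t := by
  obtain ⟨S, hS, hclique⟩ := h
  refine ⟨S.map f, by rw [Finset.card_map, hS], fun e he => ?_⟩
  obtain ⟨he, hcard⟩ := Finset.mem_powersetCard.1 he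
  obtain ⟨e, heS, rfl⟩ := Finset.subset_map_iff.1 he
  rw [Finset.card_map] at hcard
  exact mem_edges_comap.1 (hclique (Finset.mem_powersetCard.2 ⟨heS, hcard⟩))

theorem HasClique.of_map {G : RGraph r n} {f : Fin n ↪ Fin k} {t : ℕ} (hr : 0 < r) (hrt : r ≤ t)
    (h : (G.map f).HasClique t) : G.HasClique t := by
  obtain ⟨S, hS, hclique⟩ := h
  have hrange : S ⊆ Finset.univ.map f := fun u hu => by
    obtain ⟨e, hue, heS, he⟩ := Finset.exists_subsuperset_card_eq
      (Finset.singleton_subset_iff.2 hu) (n := r) (by rwa [Finset.card_singleton]) (hS ▸ hrt)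
    obtain ⟨e, -, rfl⟩ := Finset.mem_map.1 (hclique (Finset.mem_powersetCard.2 ⟨heS, he⟩))
    exact Finset.map_subset_map.2 (Finset.subset_univ e) (Finset.singleton_subset_iff.1 hue)
  obtain ⟨S, -, rfl⟩ := Finset.subset_map_iff.1 hrange
  refine ⟨S, by rwa [Finset.card_map] at hS, fun e he => ?_⟩
  rw [Finset.mem_powersetCard] at he
  exact map_mem_edges_map.1 (hclique (Finset.mem_powersetCard.2
    ⟨Finset.map_subset_map.2 he.1, by rw [Finset.card_map, he.2]⟩))

theorem exists_antitone_representative (G : RGraph r n) (hr : 0 < r) {l : ℕ} {x : Fin n → ℝ}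
    (hx : x ∈ stdSimplex ℝ (Fin n)) (hsupp : (posSupport x).card ≤ l) :
    ∃ (H : RGraph r l) (y : Fin l → ℝ), y ∈ stdSimplex ℝ (Fin l) ∧ Antitone y ∧
      H.edges.card ≤ G.edges.card ∧ (∀ t, r ≤ t → H.HasClique t → G.HasClique t) ∧
      H.weight y = G.weight x := by
  set x' : Fin (n + l) → ℝ := Fin.append x 0
  have hx'_comp : x' ∘ Fin.castAddEmb l = x := funext (Fin.append_left x 0)
  obtain ⟨T, hT, -, hTcard⟩ := Finset.exists_subsuperset_card_eq
    (Finset.subset_univ ((posSupport x).map (Fin.castAddEmb l))) (n := l) (by simpa using hsupp)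
    (by simp)
  obtain ⟨f, rfl, hf⟩ := exists_antitone_embedding x' hTcard
  have hzero : ∀ i ∉ Finset.univ.map f, x' i = 0 := by
    intro i hi
    induction i using Fin.addCases with
    | left i =>
      have : i ∉ posSupport x := fun h => hi (hT (Finset.mem_map_of_mem (Fin.castAddEmb l) h))
      simp [x', eq_zero_of_notMem_posSupport hx.1 this]
    | right i => simp [x']
  refine ⟨(G.map (Fin.castAddEmb l)).comap f, x' ∘ f, ⟨fun i => ?_, ?_⟩, hf, ?_, ?_, ?_⟩
  · simp only [Function.comp_apply]
    induction f i using Fin.addCases with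
    | left i => simpa [x'] using hx.1 i
    | right i => simp [x']
  · calc ∑ i, (x' ∘ f) i = ∑ i ∈ Finset.univ.map f, x' i := by simp
      _ = ∑ i, x' i := Finset.sum_subset (Finset.subset_univ _) fun i _ => hzero i
      _ = 1 := by simp [x', Fin.sum_univ_add, hx.2]
  · exact (card_edges_comap_le _ f).trans_eq (G.card_edges_map _)
  · exact fun t ht h => h.of_comap.of_map hr ht
  · rw [weight_comap _ f hzero, weight_map, hx'_comp]

end Transport

section LastFour

variable {s : ℕ} {y : Fin (s + 5) → ℝ}

/-- The last four of `s + 5` vertices, whose triples the exchange argument turns into non-edges. -/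
def lastFour (s : ℕ) : Finset (Fin (s + 5)) :=
  ({1, 2, 3, 4} : Finset (Fin 5)).map (Fin.natAddEmb s)

theorem isUpperSet_lastFour (s : ℕ) : IsUpperSet (lastFour s : Set (Fin (s + 5))) := by
  have h (v : Fin (s + 5)) : v ∈ lastFour s ↔ s < v := by
    induction v using Fin.addCases with
    | left i => simp [lastFour, Fin.ext_iff]; omega
    | right i => fin_cases i <;> simp [lastFour, Fin.ext_iff]
  exact fun a b hab ha => (h b).2 (((h a).1 ha).trans_le hab)

theorem card_lastFour (s : ℕ) : (lastFour s).card = 4 :=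
  Finset.card_map _

theorem notMem_map_mapEmbedding {α β : Type*} (f : α ↪ β) {K : Finset (Finset α)} {v : α}
    {e₀ : Finset α} (he₀ : ∀ e ∈ K, v ∉ e → e = e₀) {E : Finset (Finset β)} {g : Finset β}
    (hg : g ∈ E) (hv : f v ∉ g) (hE : e₀.map f ∉ E) :
    g ∉ K.map (Finset.mapEmbedding f).toEmbedding := by
  intro hgK
  obtain ⟨e, he, rfl⟩ := Finset.mem_map.1 hgK
  exact hE (he₀ e he (mt (Finset.mem_map_of_mem f) hv) ▸ hg)

theorem exists_lt_lt_of_card_eq_three {α : Type*} [LinearOrder α] {e : Finset α}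
    (he : e.card = 3) : ∃ i j k, i < j ∧ j < k ∧ e = {i, j, k} := by
  refine ⟨e.orderEmbOfFin he 0, e.orderEmbOfFin he 1, e.orderEmbOfFin he 2, by simp, by simp, ?_⟩
  conv_lhs => rw [← Finset.image_orderEmbOfFin_univ e he]
  simp [Fin.univ_succ]

theorem mul_mul_le_prod_of_forall_le {α : Type*} [LinearOrder α] {y : α → ℝ} (hy : Antitone y)
    (hy0 : ∀ i, 0 ≤ y i) {e : Finset α} (he : e.card = 3) {a b c : α}
    (h : ∀ i j k, i < j → j < k → e = {i, j, k} → i ≤ a ∧ j ≤ b ∧ k ≤ c) :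
    y a * y b * y c ≤ ∏ i ∈ e, y i := by
  obtain ⟨i, j, k, hij, hjk, rfl⟩ := exists_lt_lt_of_card_eq_three he
  obtain ⟨hia, hjb, hkc⟩ := h i j k hij hjk rfl
  rw [Finset.prod_insert (by simp [hij.ne, (hij.trans hjk).ne]), Finset.prod_pair hjk.ne,
    ← mul_assoc]
  exact mul_le_mul (mul_le_mul (hy hia) (hy hjb) (hy0 b) (hy0 i)) (hy hkc) (hy0 c)
    (mul_nonneg (hy0 i) (hy0 j))

theorem prod_map_le_prod_of_four_notMem (hy : Antitone y) (hy0 : ∀ i, 0 ≤ y i)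
    {e : Finset (Fin (s + 5))} (he : e.card = 3) (h4 : Fin.natAdd s 4 ∉ e) :
    ∏ i ∈ ({1, 2, 3} : Finset (Fin 5)).map (Fin.natAddEmb s), y i ≤ ∏ i ∈ e, y i := by
  simpa [mul_assoc] using mul_mul_le_prod_of_forall_le hy hy0 he (a := Fin.natAdd s 1)
    (b := Fin.natAdd s 2) (c := Fin.natAdd s 3) (by grind)

theorem prod_map_le_prod_of_three_notMem (hy : Antitone y) (hy0 : ∀ i, 0 ≤ y i)
    {e : Finset (Fin (s + 5))} (he : e.card = 3) (h3 : Fin.natAdd s 3 ∉ e) :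
    ∏ i ∈ ({1, 2, 4} : Finset (Fin 5)).map (Fin.natAddEmb s), y i ≤ ∏ i ∈ e, y i := by
  simpa [mul_assoc] using mul_mul_le_prod_of_forall_le hy hy0 he (a := Fin.natAdd s 1)
    (b := Fin.natAdd s 2) (c := Fin.natAdd s 4) (by grind)

theorem mul_mul_le_prod_of_three_four_notMem (hy : Antitone y) (hy0 : ∀ i, 0 ≤ y i)
    {e : Finset (Fin (s + 5))} (he : e.card = 3) (h3 : Fin.natAdd s 3 ∉ e)
    (h4 : Fin.natAdd s 4 ∉ e) :
    y (Fin.natAdd s 0) * y (Fin.natAdd s 1) * y (Fin.natAdd s 2) ≤ ∏ i ∈ e, y i :=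
  mul_mul_le_prod_of_forall_le hy hy0 he (by grind)

theorem mul_mul_le_prod_of_ne (hy : Antitone y) (hy0 : ∀ i, 0 ≤ y i)
    {e : Finset (Fin (s + 5))} (he : e.card = 3)
    (hne : e ≠ ({2, 3, 4} : Finset (Fin 5)).map (Fin.natAddEmb s)) :
    y (Fin.natAdd s 1) * y (Fin.natAdd s 3) * y (Fin.natAdd s 4) ≤ ∏ i ∈ e, y i :=
  mul_mul_le_prod_of_forall_le hy hy0 he (by
    rw [Finset.map_insert, Finset.map_insert, Finset.map_singleton] at hne
    simp only [Fin.natAddEmb_apply] at hne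
    grind)

theorem prod_map_natAddEmb_le (hy : Antitone y) (hy0 : ∀ i, 0 ≤ y i) {e : Finset (Fin 5)}
    (he : e ∈ Finset.powersetCard 3 {1, 2, 3, 4}) (h123 : e ≠ {1, 2, 3}) (h124 : e ≠ {1, 2, 4}) :
    ∏ i ∈ e.map (Fin.natAddEmb s), y i ≤
      y (Fin.natAdd s 1) * y (Fin.natAdd s 3) * y (Fin.natAdd s 4) := by
  have hcases : ∀ e ∈ Finset.powersetCard 3 {1, 2, 3, 4}, e ≠ {1, 2, 3} → e ≠ {1, 2, 4} →
      e = ({1, 3, 4} : Finset (Fin 5)) ∨ e = {2, 3, 4} := by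
    decide
  rw [Finset.prod_map]
  rcases hcases e he h123 h124 with rfl | rfl
  · simp [mul_assoc]
  · have h21 : y (Fin.natAdd s 2) ≤ y (Fin.natAdd s 1) := hy (by simp [Fin.le_def])
    have h34 := mul_nonneg (hy0 (Fin.natAdd s 3)) (hy0 (Fin.natAdd s 4))
    simpa [mul_assoc] using mul_le_mul_of_nonneg_right h21 h34

theorem prod_map_add_prod_map_le (hy : Antitone y) (hy0 : ∀ i, 0 ≤ y i) :
    ∏ i ∈ ({1, 2, 3} : Finset (Fin 5)).map (Fin.natAddEmb s), y i +
      ∏ i ∈ ({1, 2, 4} : Finset (Fin 5)).map (Fin.natAddEmb s), y i ≤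
    y (Fin.natAdd s 0) * y (Fin.natAdd s 1) * y (Fin.natAdd s 2) +
      y (Fin.natAdd s 1) * y (Fin.natAdd s 3) * y (Fin.natAdd s 4) := by
  have h20 : y (Fin.natAdd s 2) ≤ y (Fin.natAdd s 0) := hy (by simp [Fin.le_def])
  have h32 : y (Fin.natAdd s 3) ≤ y (Fin.natAdd s 2) := hy (by simp [Fin.le_def])
  have h42 : y (Fin.natAdd s 4) ≤ y (Fin.natAdd s 2) := hy (by simp [Fin.le_def])
  have hcross := mul_nonneg (sub_nonneg.2 h32) (sub_nonneg.2 h42)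
  have hgap := mul_nonneg (hy0 (Fin.natAdd s 2)) (sub_nonneg.2 h20)
  rw [Finset.prod_map, Finset.prod_map, Finset.prod_insert (by decide),
    Finset.prod_pair (by decide), Finset.prod_insert (by decide), Finset.prod_pair (by decide)]
  simp only [Fin.natAddEmb_apply]
  linear_combination mul_nonneg (hy0 (Fin.natAdd s 1)) (add_nonneg hcross hgap)

/- The triples `{1, 2, 3}` and `{1, 2, 4}` are paid for by edges of `R` avoiding `4` and `3`
respectively; every other triple of `K` weighs at most `y₁y₃y₄`, and every edge of `R` outside `K`
weighs at least that much. -/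
theorem exists_superset_weight_le (hy : Antitone y) (hy0 : ∀ i, 0 ≤ y i) {R : RGraph 3 (s + 5)}
    (hR : ∀ v, ∃ e ∈ R.edges, v ∉ e) {K : Finset (Finset (Fin 5))}
    (hK : K ⊆ Finset.powersetCard 3 {1, 2, 3, 4}) (h123 : {1, 2, 3} ∈ K) (h124 : {1, 2, 4} ∈ K)
    (h234 : {2, 3, 4} ∈ K) (hcard : K.card ≤ R.edges.card) :
    ∃ F : RGraph 3 (s + 5), K.map (Finset.mapEmbedding (Fin.natAddEmb s)).toEmbedding ⊆ F.edges ∧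
      F.edges.card = R.edges.card ∧ F.weight y ≤ R.weight y := by
  obtain ⟨f, hf, hf4⟩ := hR (Fin.natAdd s 4)
  obtain ⟨g, hg, hg3⟩ := hR (Fin.natAdd s 3)
  have h4 : ∀ e ∈ K, 4 ∉ e → e = {1, 2, 3} := fun e he =>
    (by decide : ∀ e ∈ Finset.powersetCard 3 {1, 2, 3, 4}, (4 : Fin 5) ∉ e → e = {1, 2, 3})
      e (hK he)
  have h3 : ∀ e ∈ K, 3 ∉ e → e = {1, 2, 4} := fun e he =>
    (by decide : ∀ e ∈ Finset.powersetCard 3 {1, 2, 3, 4}, (3 : Fin 5) ∉ e → e = {1, 2, 4})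
      e (hK he)
  set φ := (Finset.mapEmbedding (Fin.natAddEmb s)).toEmbedding
  set τ := y (Fin.natAdd s 1) * y (Fin.natAdd s 3) * y (Fin.natAdd s 4)
  have hfg : f = g → ∏ i ∈ φ {1, 2, 3}, y i + ∏ i ∈ φ {1, 2, 4}, y i ≤ ∏ i ∈ f, y i + τ := by
    intro hfg
    have := mul_mul_le_prod_of_three_four_notMem hy hy0 (R.card_of_mem f hf) (hfg ▸ hg3) hf4
    exact (prod_map_add_prod_map_le hy hy0).trans (add_le_add_left this τ)
  have hKτ : ∀ e ∈ K.map φ, e ≠ φ {1, 2, 3} → e ≠ φ {1, 2, 4} → ∏ i ∈ e, y i ≤ τ := by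
    intro _ he hep heq
    obtain ⟨e, heK, rfl⟩ := Finset.mem_map.1 he
    exact prod_map_natAddEmb_le hy hy0 (hK heK) (mt (congrArg φ) hep) (mt (congrArg φ) heq)
  have hRτ : ∀ e ∈ R.edges \ K.map φ, τ ≤ ∏ i ∈ e, y i := by
    intro e he
    rw [Finset.mem_sdiff] at he
    exact mul_mul_le_prod_of_ne hy hy0 (R.card_of_mem e he.1) fun h =>
      he.2 (h ▸ Finset.mem_map_of_mem φ h234)
  obtain ⟨F, hKF, hFR, hFcard, hF⟩ := exists_superset_sum_le_of_pair (fun e => ∏ i ∈ e, y i) τ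
    ((Finset.card_map φ).trans_le hcard) (Finset.mem_map_of_mem φ h123)
    (Finset.mem_map_of_mem φ h124) (φ.injective.ne (by decide)) hf hg
    (notMem_map_mapEmbedding _ h4 hf hf4) (notMem_map_mapEmbedding _ h3 hg hg3)
    (prod_map_le_prod_of_four_notMem hy hy0 (R.card_of_mem f hf) hf4)
    (prod_map_le_prod_of_three_notMem hy hy0 (R.card_of_mem g hg) hg3) hfg hKτ hRτ
  refine ⟨⟨F, fun e he => ?_⟩, hKF, hFcard, hF⟩
  rcases Finset.mem_union.1 (hFR he) with he | he
  · exact R.card_of_mem e he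
  · obtain ⟨e, heK, rfl⟩ := Finset.mem_map.1 he
    exact (Finset.card_map _).trans (Finset.mem_powersetCard.1 (hK heK)).2

end LastFour

section Compression

variable {r n : ℕ}

instance : Finite (RGraph r n) :=
  Finite.of_injective RGraph.edges fun _ _ => RGraph.ext

/-- The `r`-graph obtained from `G` by replacing the edge `e` by `e'`. -/
def replaceEdge (G : RGraph r n) (e : Finset (Fin n)) {e' : Finset (Fin n)} (he' : e'.card = r) :
    RGraph r n where
  edges := insert e' (G.edges.erase e)
  card_of_mem := (Finset.forall_mem_insert _ _ _).2
    ⟨he', fun _ h => G.card_of_mem _ (Finset.mem_of_mem_erase h)⟩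

theorem sum_replaceEdge_add {M : Type*} [AddCommMonoid M] {G : RGraph r n}
    {e e' : Finset (Fin n)} (he : e ∈ G.edges) (he' : e'.card = r) (hG : e' ∉ G.edges)
    (φ : Finset (Fin n) → M) :
    ∑ f ∈ (G.replaceEdge e he').edges, φ f + φ e = ∑ f ∈ G.edges, φ f + φ e' := by
  rw [replaceEdge, Finset.sum_insert fun h => hG (Finset.mem_of_mem_erase h),
    ← Finset.sum_erase_add G.edges φ he]
  abel

theorem subset_edges_replaceEdge {G : RGraph r n} {e e' : Finset (Fin n)} (he' : e'.card = r)
    {K : Finset (Finset (Fin n))} (hK : K ⊆ G.edges) (he : e ∉ K) :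
    K ⊆ (G.replaceEdge e he').edges :=
  (Finset.subset_erase.2 ⟨hK, he⟩).trans (Finset.subset_insert _ _)

theorem card_edges_replaceEdge {G : RGraph r n} {e e' : Finset (Fin n)} (he : e ∈ G.edges)
    (he' : e'.card = r) (hG : e' ∉ G.edges) :
    (G.replaceEdge e he').edges.card = G.edges.card := by
  have := sum_replaceEdge_add he he' hG fun _ => 1
  rwa [add_left_inj, ← Finset.card_eq_sum_ones, ← Finset.card_eq_sum_ones] at this

theorem weight_replaceEdge_image_le {G : RGraph r n} {y : Fin n → ℝ} (hy : Antitone y)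
    (hy0 : ∀ i, 0 ≤ y i) {i j : Fin r → Fin n} (hi : StrictMono i) (hj : StrictMono j)
    (hij : i ≤ j) (hiG : Finset.univ.image i ∈ G.edges) (hjr : (Finset.univ.image j).card = r)
    (hjG : Finset.univ.image j ∉ G.edges) :
    (G.replaceEdge (Finset.univ.image i) hjr).weight y ≤ G.weight y := by
  have hprod : ∏ v ∈ Finset.univ.image j, y v ≤ ∏ v ∈ Finset.univ.image i, y v := by
    rw [Finset.prod_image hi.injective.injOn, Finset.prod_image hj.injective.injOn]
    exact Finset.prod_le_prod (fun p _ => hy0 _) fun p _ => hy (hij p)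
  have hsum : (G.replaceEdge (Finset.univ.image i) hjr).weight y + _ = G.weight y + _ :=
    sum_replaceEdge_add hiG hjr hjG fun e => ∏ v ∈ e, y v
  linarith

/- Among the graphs satisfying the first three conditions, take one whose edges have the largest
total sum of vertices: shifting an edge to the right would increase that sum. -/
theorem exists_compl_leftCompressed (F : RGraph r n) {y : Fin n → ℝ} (hy : Antitone y)
    (hy0 : ∀ i, 0 ≤ y i) {S : Finset (Fin n)} (hS : IsUpperSet (S : Set (Fin n)))
    (hSF : Finset.powersetCard r S ⊆ F.edges) :
    ∃ F' : RGraph r n, Finset.powersetCard r S ⊆ F'.edges ∧ F'.edges.card = F.edges.card ∧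
      F'.weight y ≤ F.weight y ∧ F'.compl.LeftCompressed := by
  obtain ⟨F', ⟨hSF', hcard, hweight⟩, hmax⟩ := Set.exists_max_image
    {F' : RGraph r n | Finset.powersetCard r S ⊆ F'.edges ∧ F'.edges.card = F.edges.card ∧
      F'.weight y ≤ F.weight y}
    (fun F' => ∑ e ∈ F'.edges, ∑ v ∈ e, (v : ℕ)) (Set.toFinite _) ⟨F, hSF, rfl, le_rfl⟩
  refine ⟨F', hSF', hcard, hweight, fun i j hi hj hij hjF => ?_⟩
  obtain ⟨hjr, hjF⟩ := mem_edges_compl.1 hjF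
  refine mem_edges_compl.2 ⟨by simp [Finset.card_image_of_injective _ hi.injective], fun hiF => ?_⟩
  have hiS : Finset.univ.image i ∉ Finset.powersetCard r S := fun h => by
    rw [Finset.mem_powersetCard, Finset.image_subset_iff] at h
    exact hjF (hSF' (Finset.mem_powersetCard.2
      ⟨Finset.image_subset_iff.2 fun p hp => hS (hij p) (h.1 p hp), hjr⟩))
  have hmax' := hmax (F'.replaceEdge (Finset.univ.image i) hjr)
    ⟨subset_edges_replaceEdge hjr hSF' hiS, (card_edges_replaceEdge hiF hjr hjF).trans hcard,
      (weight_replaceEdge_image_le hy hy0 hi hj hij hiF hjr hjF).trans hweight⟩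
  have hji : ∑ p, (j p : ℕ) ≤ ∑ p, (i p : ℕ) := by
    have hsum := sum_replaceEdge_add hiF hjr hjF fun e => ∑ v ∈ e, (v : ℕ)
    rw [Finset.sum_image hi.injective.injOn, Finset.sum_image hj.injective.injOn] at hsum
    lia
  have hval := (Finset.sum_eq_sum_iff_of_le fun p _ => Fin.val_le_of_le (hij p)).1
    (hji.antisymm' (Finset.sum_le_sum fun p _ => hij p))
  have hij_eq : i = j := funext fun p => Fin.ext (hval p (Finset.mem_univ p))
  exact hjF (hij_eq ▸ hiF)

end Compression

section Reduction

variable {n s m : ℕ}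

theorem exists_nonedges (G : RGraph 3 n) (hG : 0 < G.edges.card)
    (hm : G.edges.card ≤ (s + 4).choose 3 + (s + 3).choose 2) (hclique : ¬ G.HasClique (s + 4))
    (hL : (complete 3 (s + 4)).lagrangian ≤ G.lagrangian) :
    ∃ (R : RGraph 3 (s + 5)) (y : Fin (s + 5) → ℝ), y ∈ stdSimplex ℝ (Fin (s + 5)) ∧ Antitone y ∧
      (s + 5).choose 3 ≤ R.edges.card + G.edges.card ∧ (∀ v, ∃ e ∈ R.edges, v ∉ e) ∧
      R.weight y + G.lagrangian = (complete 3 (s + 5)).weight y := by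
  obtain ⟨x, hx, hopt⟩ := G.exists_weight_eq_lagrangian three_pos hG
  obtain ⟨H, y, hy, hanti, hcard, hH, hweight⟩ := G.exists_antitone_representative three_pos hx
    (G.card_posSupport_le (Nat.le_add_left 4 s) hm hL hx hopt)
  refine ⟨H.compl, y, hy, hanti, ?_, ?_, ?_⟩
  · exact H.card_compl_add_card ▸ Nat.add_le_add_left hcard _
  · exact H.exists_notMem_compl_of_not_hasClique (mt (hH (s + 4) (by lia)) hclique)
  · rw [← hopt, ← hweight, weight_compl_add_weight]

theorem exists_subgraph_card_eq {r : ℕ} (F : RGraph r n) {y : Fin n → ℝ} (hy : ∀ i, 0 ≤ y i)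
    {K : Finset (Finset (Fin n))} (hK : K ⊆ F.edges) {N : ℕ} (hKN : K.card ≤ N)
    (hN : N ≤ F.edges.card) :
    ∃ F' : RGraph r n, K ⊆ F'.edges ∧ F'.edges.card = N ∧ F'.weight y ≤ F.weight y := by
  obtain ⟨E, hKE, hEF, hE⟩ := Finset.exists_subsuperset_card_eq hK hKN hN
  exact ⟨⟨E, fun e he => F.card_of_mem e (hEF he)⟩, hKE, hE,
    Finset.sum_le_sum_of_subset_of_nonneg hEF fun e _ _ => Finset.prod_nonneg fun i _ => hy i⟩

theorem exists_leftCompressed_ge (G : RGraph 3 n) (hG : 0 < G.edges.card)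
    (hm : G.edges.card ≤ (s + 4).choose 3 + (s + 3).choose 2)
    (hm4 : G.edges.card + 4 ≤ (s + 5).choose 3) (hclique : ¬ G.HasClique (s + 4))
    (hL : (complete 3 (s + 4)).lagrangian ≤ G.lagrangian) :
    ∃ G' : RGraph 3 (s + 5), G'.LeftCompressed ∧ G'.edges.card = G.edges.card ∧
      ¬ G'.HasClique (s + 4) ∧ G.lagrangian ≤ G'.lagrangian := by
  obtain ⟨R, y, hy, hanti, hcard, hR, hweight⟩ := G.exists_nonedges hG hm hclique hL
  have hlast : (Finset.powersetCard 3 (lastFour s)).card = 4 := by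
    rw [Finset.card_powersetCard, card_lastFour]
    rfl
  obtain ⟨F₁, hKF₁, hF₁card, hF₁⟩ := exists_superset_weight_le hanti hy.1 hR
    (K := Finset.powersetCard 3 {1, 2, 3, 4}) subset_rfl (by decide) (by decide) (by decide)
    (show 4 ≤ R.edges.card by lia)
  rw [← Finset.powersetCard_map] at hKF₁
  obtain ⟨F₂, hKF₂, hF₂card, hF₂⟩ := F₁.exists_subgraph_card_eq hy.1 hKF₁
    (N := (s + 5).choose 3 - G.edges.card) (hlast.trans_le (by lia)) (by lia)
  obtain ⟨F, hKF, hFcard, hF, hcompressed⟩ :=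
    F₂.exists_compl_leftCompressed hanti hy.1 (isUpperSet_lastFour s) hKF₂
  refine ⟨F.compl, hcompressed, ?_, not_hasClique_compl hKF ?_, ?_⟩
  · have := F.card_compl_add_card
    lia
  · rw [card_lastFour]
    lia
  · calc G.lagrangian = (complete 3 (s + 5)).weight y - R.weight y := by linarith
      _ ≤ (complete 3 (s + 5)).weight y - F.weight y := by linarith
      _ = F.compl.weight y := by linarith [F.weight_compl_add_weight y]
      _ ≤ F.compl.lagrangian := F.compl.weight_le_lagrangian hy

theorem exists_leftCompressed_isGreatest (hm0 : 0 < m)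
    (hm : m ≤ (s + 4).choose 3 + (s + 3).choose 2) (hm4 : m + 4 ≤ (s + 5).choose 3)
    (hPZ : ¬ PengZhaoConjecture 3 m (s + 5)) :
    ∃ G : RGraph 3 (s + 5), G.LeftCompressed ∧ G.edges.card = m ∧ ¬ G.HasClique (s + 4) ∧
      IsGreatest (lagrangiansWithoutClique 3 m (s + 4)) G.lagrangian := by
  unfold PengZhaoConjecture at hPZ
  push Not at hPZ
  obtain ⟨n₀, G₀, rfl, hG₀, hL₀⟩ := hPZ
  obtain ⟨G₁, hG₁, hG₁card, hG₁clique, hL₁⟩ := G₀.exists_leftCompressed_ge hm0 hm hm4 hG₀ hL₀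
  obtain ⟨G, ⟨hG, hGcard, hGclique⟩, hmax⟩ := Set.exists_max_image
    {G : RGraph 3 (s + 5) | G.LeftCompressed ∧ G.edges.card = G₀.edges.card ∧
      ¬ G.HasClique (s + 4)}
    lagrangian (Set.toFinite _) ⟨G₁, hG₁, hG₁card, hG₁clique⟩
  refine ⟨G, hG, hGcard, hGclique, ⟨s + 5, G, hGcard, hGclique, rfl⟩, ?_⟩
  rintro _ ⟨n, H, hHcard, hHclique, rfl⟩
  rcases le_total (complete 3 (s + 4)).lagrangian H.lagrangian with hL | hL
  · rw [← hHcard] at hm0 hm hm4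
    obtain ⟨H', hH', hH'card, hH'clique, hHH'⟩ := H.exists_leftCompressed_ge hm0 hm hm4 hHclique hL
    exact hHH'.trans (hmax H' ⟨hH', hH'card.trans hHcard, hH'clique⟩)
  · exact hL.trans (hL₀.trans (hL₁.trans (hmax G₁ ⟨hG₁, hG₁card, hG₁clique⟩)))

end Reduction

section SmallCases

variable {m : ℕ}

/- The left-hand side is the weight of the `3`-graph on `{0, 1, 2, 3, 4}` whose non-edges are
`{1, 2, 3}`, `{1, 2, 4}` and `{2, 3, 4}`. -/
theorem seven_edge_weight_lt {a b c d e : ℝ} (ha : 0 ≤ a) (hb : 0 ≤ b) (he : 0 ≤ e) (hed : e ≤ d)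
    (hdc : d ≤ c) (h : a + b + c + d + e = 1) :
    a * (b * c + b * d + b * e + c * d + c * e + d * e) + b * d * e < 1 / 16 := by
  obtain ⟨t, ht⟩ : ∃ t, t = b + c + d + e := ⟨_, rfl⟩
  have ht0 : 0 ≤ t := by linarith
  have hpairs : b * c + b * d + b * e + c * d + c * e + d * e ≤ 3 / 8 * t ^ 2 := by
    rw [ht]
    linarith [sq_nonneg (b - c), sq_nonneg (b - d), sq_nonneg (b - e), sq_nonneg (c - d),
      sq_nonneg (c - e), sq_nonneg (d - e)]
  have hde : d * e ≤ ((t - b) / 3) ^ 2 := by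
    have hsq : (2 * d + e) ^ 2 ≤ (t - b) ^ 2 := by gcongr <;> linarith
    have := mul_nonneg (sub_nonneg.2 hed) (show 0 ≤ 4 * d - e by linarith)
    linarith
  have hbde : b * d * e ≤ 4 / 243 * t ^ 3 := by
    have := mul_nonneg (show 0 ≤ 4 * t - 3 * b by linarith) (sq_nonneg (3 * b - t))
    linarith [mul_le_mul_of_nonneg_left hde hb]
  calc a * (b * c + b * d + b * e + c * d + c * e + d * e) + b * d * e
      ≤ a * (3 / 8 * t ^ 2) + 4 / 243 * t ^ 3 := by gcongr
    _ = 3 / 8 * t ^ 2 - 697 / 1944 * t ^ 3 := by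
        rw [show a = 1 - t by linarith]
        ring
    _ < 1 / 16 := by nlinarith [mul_nonneg ht0 (sq_nonneg (t - 7 / 10)), sq_nonneg (t - 7 / 10)]

theorem weight_complete_three_five (y : Fin 5 → ℝ) :
    (complete 3 5).weight y =
      y 0 * (y 1 * y 2 + y 1 * y 3 + y 1 * y 4 + y 2 * y 3 + y 2 * y 4 + y 3 * y 4) +
        y 1 * y 3 * y 4 + (y 1 * y 2 * y 3 + y 1 * y 2 * y 4 + y 2 * y 3 * y 4) := by
  have hedges : (complete 3 5).edges = {{0, 1, 2}, {0, 1, 3}, {0, 1, 4}, {0, 2, 3}, {0, 2, 4},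
      {0, 3, 4}, {1, 2, 3}, {1, 2, 4}, {1, 3, 4}, {2, 3, 4}} := by decide
  rw [weight, hedges]
  iterate 9 rw [Finset.sum_insert (by decide)]
  simp only [Finset.mem_insert, zero_ne_one, Finset.mem_singleton, Fin.reduceEq, or_self,
    not_false_eq_true, Finset.prod_insert, Finset.prod_singleton, Finset.sum_singleton]
  ring

theorem pengZhaoConjecture_seven_five : PengZhaoConjecture 3 7 5 := by
  intro n G hcard hclique
  by_contra! hL
  obtain ⟨R, y, hy, hanti, hRcard, hR, hweight⟩ :=
    G.exists_nonedges (s := 0) (by lia) (hcard.trans_le (by decide)) hclique hL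
  rw [hcard] at hRcard
  obtain ⟨F, hKF, -, hF⟩ := exists_superset_weight_le hanti hy.1 hR
    (K := {{1, 2, 3}, {1, 2, 4}, {2, 3, 4}}) (by decide) (by decide) (by decide) (by decide)
    (Finset.card_le_three.trans (Nat.le_of_add_le_add_right (b := 7) hRcard))
  have hF' : y 1 * y 2 * y 3 + y 1 * y 2 * y 4 + y 2 * y 3 * y 4 ≤ F.weight y := by
    have h := Finset.sum_le_sum_of_subset_of_nonneg (f := fun e => ∏ i ∈ e, y i) hKF fun e _ _ =>
      Finset.prod_nonneg fun i _ => hy.1 i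
    rw [Finset.sum_map, Finset.sum_insert (by decide), Finset.sum_pair (by decide)] at h
    simpa [weight, Fin.natAddEmb, Fin.natAdd_zero, mul_assoc, add_assoc] using h
  have hlow : 1 / 16 ≤ (complete 3 4).lagrangian := by
    have h := choose_le_pow_mul_lagrangian_complete (r := 3) (q := 4) four_pos
    rw [show Nat.choose 4 3 = 4 from rfl] at h
    norm_num1 at h
    linarith
  have hsum : y 0 + y 1 + y 2 + y 3 + y 4 = 1 := by
    rw [← hy.2]
    exact (Fin.sum_univ_five y).symm
  have hlt := seven_edge_weight_lt (hy.1 0) (hy.1 1) (hy.1 4) (hanti (by decide))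
    (hanti (by decide)) hsum
  linarith [weight_complete_three_five y]

theorem pengZhaoConjecture_four (hm : 0 < m) : PengZhaoConjecture 3 m 4 := by
  rintro n G rfl hclique
  obtain ⟨e, he⟩ := Finset.card_pos.1 hm
  have hself := Finset.powersetCard_self e
  rw [G.card_of_mem e he] at hself
  exact absurd ⟨e, G.card_of_mem e he, by simpa [hself] using he⟩ hclique

end SmallCases

end RGraph

theorem lemma3p1_general (m l : ℕ) (hm : 0 < m)
    (hupp : m ≤ (l - 1).choose 3 + (l - 2).choose 2) :
    (∃ G : RGraph 3 l, G.LeftCompressed ∧ G.edges.card = m ∧ ¬ G.HasClique (l - 1) ∧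
      IsGreatest (RGraph.lagrangiansWithoutClique 3 m (l - 1)) G.lagrangian) ∨
    RGraph.PengZhaoConjecture 3 m l := by
  match l with
  | 0 | 1 | 2 | 3 => exact absurd hupp (Nat.not_le.2 hm)
  | 4 => exact Or.inr (RGraph.pengZhaoConjecture_four hm)
  | s + 5 =>
    refine or_iff_not_imp_right.2 fun hPZ => ?_
    have hchoose : (s + 5).choose 3 = (s + 4).choose 3 + (s + 3).choose 2 + (s + 3) := by
      rw [Nat.choose_succ_succ' (s + 4) 2, Nat.choose_succ_succ' (s + 3) 1, Nat.choose_one_right]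
      ring
    refine RGraph.exists_leftCompressed_isGreatest hm hupp ?_ hPZ
    by_contra! hm4
    change m ≤ (s + 4).choose 3 + (s + 3).choose 2 at hupp
    obtain rfl : s = 0 := by lia
    obtain rfl : m = 7 := le_antisymm hupp (Nat.lt_of_add_lt_add_right (n := 4) hm4)
    exact hPZ RGraph.pengZhaoConjecture_seven_five

theorem lemma3p1 (m l : ℕ) (hm : 0 < m) (hl : 0 < l)
    (hlow : (l - 1).choose 3 ≤ m)
    (hupp : m ≤ (l - 1).choose 3 + (l - 2).choose 2) :
    (∃ G : RGraph 3 l, G.LeftCompressed ∧ G.edges.card = m ∧ ¬ G.HasClique (l - 1) ∧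
      IsGreatest (RGraph.lagrangiansWithoutClique 3 m (l - 1)) G.lagrangian) ∨
    RGraph.PengZhaoConjecture 3 m l :=
  lemma3p1_general m l hm hupp
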